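/- Let $\mathscr{E}$ be the ring of germs at the origin of smooth functions $(x,\lambda)\mapsto f(x,\lambda)\in\mathbb{R}$ on $\mathbb{R}^2$, let $\mathcal{M}=\langle x,\lambda\rangle\subset\mathscr{E}$, and fix a local order $\prec$ on monomials (a total order compatible with multiplication, with $x\prec1$ and $\lambda\prec 1$). $\mathrm{Terms}(f)$ is the set of nonzero terms $a_{ij}x^i\lambda^j$ of the Taylor expansion of $f$ at $0$; $LT(f)$ is its $\prec$-largest element, with $LT(f)=0$ if $f$ is flat. A finite set $G$ is a standard basis of an ideal $I$ if $G$ generates $I$ and $\langle LT(f): f\in I\rangle=\langle LT(g): g\in G\rangle$. It is reduced if every leading coefficient is $1$ and, for $g,h\in G$ and $p\in\mathrm{Terms}(h)$, $LT(g)\mid p$ only if $g=h$ and $p=LT(g)$; it is monomial if its elements are monomials $x^a\lambda^b$. A vector subspace $V\subseteq\mathscr{E}$ (for instance an ideal) has finite codimension if $\mathcal{M}^k\subseteq V$ for some $k$. An ideal $I$ is intrinsic if $h\in I$ implies $S(x,\lambda)\,h(X(x,\lambda),\lambda)\in I$ for all smooth germs $S,X$ with $S>0$, $X_x>0$ and $X(0,0)=0$.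 $\mathrm{Itr}(V)$ is the largest intrinsic ideal contained in the vector subspace $V$. 1. Let $I$ be an intrinsic ideal that has finite codimension or, more generally, is generated by monomials. Then $I=\sum_i\mathcal{M}^{m_i}\langle\lambda^{n_i}\rangle$ for a finite (possibly empty) family of nonnegative integers with $n_i$ strictly increasing and $m_i+n_i$ strictly decreasing, where some $n_i$ is $0$ if $I$ has finite codimension; and $I$ has a reduced monomial standard basis that contains its intrinsic generators, that is, all the monomials $x^{m_i}\lambda^{n_i}$ of such a representation. 2. Let $V$ be a vector subspace of $\mathscr{E}$ of finite codimension. Then there are a reduced monomial standard basis $\{f_j\}$ of $\mathrm{Itr}(V)$ and finitely many $g_1,\dots,g_r\in\mathscr{E}$ with $V=\mathrm{Itr}(V)+\langle g_1,\dots,g_r\rangle_{\mathbb{R}}$ such that no term of any $g_i$ is divisible by any $f_j$, and $\mathrm{Itr}(V)\cap\bigcup_i\mathrm{Terms}(g_i)=\emptyset$. 3. Let $I$ be a finitely generated ideal of $\mathscr{E}$. Then there are finitely many monomials $f_j$ and finitely many $g_1,\dots,g_r\in\mathscr{E}$ with $I=\mathrm{Itr}(I)+\langle g_1,\dots,g_r\rangle_{\mathscr{E}}$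 such that no term of any $g_i$ is divisible by any $f_j$, and $\mathrm{Itr}(I)\cap\bigcup_i\mathrm{Terms}(g_i)=\emptyset$. Here $\{f_j\}$ is a reduced monomial standard basis of the ideal generated by the monomials in $\mathrm{Itr}(I)$, and it is a reduced monomial standard basis of $\mathrm{Itr}(I)$ itself if $I$ has finite codimension or $\mathrm{Itr}(I)$ is generated by monomials. -/

import Mathlib

open Filter Topology
open scoped ContDiff Nat

noncomputable section

namespace SingularityGerms

/-! ### The ring of smooth germs in two variables `(x, l)` at the origin -/

/-- `f` is smooth on a neighbourhood of the origin. -/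
def SmoothNearZero (f : ℝ × ℝ → ℝ) : Prop := ∀ᶠ p in 𝓝 (0 : ℝ × ℝ), ContDiffAt ℝ ∞ f p

/-- The ring of germs at the origin of smooth functions of `(x, l)`, as a subring of the ring of
all germs of functions at the origin. -/
def smoothGermSubring : Subring (Germ (𝓝 (0 : ℝ × ℝ)) ℝ) where
  carrier := {g | ∃ f : ℝ × ℝ → ℝ, SmoothNearZero f ∧ (f : Germ (𝓝 (0 : ℝ × ℝ)) ℝ) = g}
  mul_mem' := by
    rintro _ _ ⟨f, hf, rfl⟩ ⟨g, hg, rfl⟩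
    exact ⟨f * g, by filter_upwards [hf, hg] with p h1 h2 using h1.mul h2, rfl⟩
  one_mem' := ⟨1, Eventually.of_forall fun _ => contDiffAt_const, rfl⟩
  add_mem' := by
    rintro _ _ ⟨f, hf, rfl⟩ ⟨g, hg, rfl⟩
    exact ⟨f + g, by filter_upwards [hf, hg] with p h1 h2 using h1.add h2, rfl⟩
  zero_mem' := ⟨0, Eventually.of_forall fun _ => contDiffAt_const, rfl⟩
  neg_mem' := by
    rintro _ ⟨f, hf, rfl⟩
    exact ⟨-f, by filter_upwards [hf] with p h1 using h1.neg, rfl⟩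

/-- Smooth germs at the origin of `ℝ × ℝ`. -/
abbrev SmoothGerm : Type := smoothGermSubring

/-- The germ of a function which is smooth near the origin. -/
def germOf (f : ℝ × ℝ → ℝ) (hf : SmoothNearZero f) : SmoothGerm := ⟨f, f, hf, rfl⟩

/-- Real numbers as constant germs. -/
def constGerm : ℝ →+* SmoothGerm where
  toFun c := germOf (fun _ => c) (Eventually.of_forall fun _ => contDiffAt_const)
  map_one' := rfl
  map_mul' _ _ := rfl
  map_zero' := rfl
  map_add' _ _ := rfl

/-- The `ℝ`-algebra (in particular `ℝ`-vector space) structure, given by the constant germs. -/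
instance : Algebra ℝ SmoothGerm := constGerm.toAlgebra

/-- The germ of the state variable `x`. -/
def xGerm : SmoothGerm := germOf Prod.fst (Eventually.of_forall fun _ => contDiffAt_fst)

/-- The germ of the distinguished parameter `l`. -/
def lGerm : SmoothGerm := germOf Prod.snd (Eventually.of_forall fun _ => contDiffAt_snd)

/-- The monomial germ `x ^ a * l ^ b` with exponent `(a, b)`. -/
def monomialGerm (e : ℕ × ℕ) : SmoothGerm := xGerm ^ e.1 * lGerm ^ e.2

/-- The ideal `⟨x, l⟩`. -/
def maxIdeal : Ideal SmoothGerm := Ideal.span {xGerm, lGerm}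

/-- A vector subspace (for instance an ideal) has finite codimension when it contains some power
of the maximal ideal. -/
def HasFiniteCodim (V : Submodule ℝ SmoothGerm) : Prop :=
  ∃ k : ℕ, ((maxIdeal ^ k : Ideal SmoothGerm) : Set SmoothGerm) ⊆ V

/-! ### Taylor coefficients, terms -/

/-- The coefficient of `x ^ a * l ^ b` in the Taylor expansion at the origin:
the partial derivative of order `(a, b)` at `(0, 0)` divided by `a! * b!`. -/
def taylorCoeffFun (e : ℕ × ℕ) (f : ℝ × ℝ → ℝ) : ℝ :=
  iteratedDeriv e.1 (fun x => iteratedDeriv e.2 (fun l => f (x, l)) 0) 0 / (e.1 ! * e.2 !)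

theorem taylorCoeffFun_congr (e : ℕ × ℕ) {f g : ℝ × ℝ → ℝ} (h : f =ᶠ[𝓝 0] g) :
    taylorCoeffFun e f = taylorCoeffFun e g := by
  have h1 : ∀ᶠ x in 𝓝 (0 : ℝ), ∀ᶠ l in 𝓝 (0 : ℝ), f (x, l) = g (x, l) := by
    have h2 : ∀ᶠ p in 𝓝 (0 : ℝ) ×ˢ 𝓝 (0 : ℝ), f p = g p := by
      rw [← nhds_prod_eq]; exact h
    exact h2.curry
  unfold taylorCoeffFun
  congr 1
  apply Filter.EventuallyEq.iteratedDeriv_eq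
  filter_upwards [h1] with x hx
  exact Filter.EventuallyEq.iteratedDeriv_eq _ hx

/-- The coefficient of the monomial with exponent `e` in the Taylor expansion of a germ. -/
def taylorCoeff (f : SmoothGerm) (e : ℕ × ℕ) : ℝ :=
  Germ.liftOn f.1 (taylorCoeffFun e) fun _ _ h => taylorCoeffFun_congr e h

/-- The nonzero terms (coefficient times monomial) of the Taylor expansion of a germ. -/
def terms (f : SmoothGerm) : Set SmoothGerm :=
  {p | ∃ e : ℕ × ℕ, taylorCoeff f e ≠ 0 ∧ p = taylorCoeff f e • monomialGerm e}

/-! ### Local orders, leading terms, standard bases -/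

/-- A local order on the monomials `x ^ a * l ^ b`, which are represented by their exponents. -/
structure LocalOrder where
  /-- the strict order `≺` -/
  lt : ℕ × ℕ → ℕ × ℕ → Prop
  strictTotal : IsStrictTotalOrder (ℕ × ℕ) lt
  add_right : ∀ a b c : ℕ × ℕ, lt a b → lt (a + c) (b + c)
  x_lt_one : lt (1, 0) (0, 0)
  l_lt_one : lt (0, 1) (0, 0)

/-- `e` is the exponent of the leading term of `f`. -/
def IsLeadingExponent (ord : LocalOrder) (f : SmoothGerm) (e : ℕ × ℕ) : Prop :=
  taylorCoeff f e ≠ 0 ∧ ∀ e', taylorCoeff f e' ≠ 0 → e' ≠ e → ord.lt e' e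

open Classical in
/-- The leading term; it is `0` for a flat germ. -/
def leadingTerm (ord : LocalOrder) (f : SmoothGerm) : SmoothGerm :=
  if h : ∃ e, IsLeadingExponent ord f e then taylorCoeff f h.choose • monomialGerm h.choose else 0

open Classical in
/-- The leading coefficient; it is `0` for a flat germ. -/
def leadingCoeff (ord : LocalOrder) (f : SmoothGerm) : ℝ :=
  if h : ∃ e, IsLeadingExponent ord f e then taylorCoeff f h.choose else 0

/-- The ideal generated by the leading terms of the elements of `I`. -/
def leadingTermIdeal (ord : LocalOrder) (I : Ideal SmoothGerm) : Ideal SmoothGerm :=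
  Ideal.span (leadingTerm ord '' (I : Set SmoothGerm))

/-- The finite set `G` generates `I`, and the leading terms of its elements generate the leading
term ideal of `I`. -/
def IsStandardBasis (ord : LocalOrder) (I : Ideal SmoothGerm) (G : Finset SmoothGerm) : Prop :=
  Ideal.span (G : Set SmoothGerm) = I ∧
    leadingTermIdeal ord I = Ideal.span (leadingTerm ord '' (G : Set SmoothGerm))

/-- A standard basis is reduced when all leading coefficients are `1` and no leading term of an
element divides a term of an element, other than itself. -/
def IsReducedStandardBasis (ord : LocalOrder) (I : Ideal SmoothGerm) (G : Finset SmoothGerm) :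
    Prop :=
  IsStandardBasis ord I G ∧ (∀ g ∈ G, leadingCoeff ord g = 1) ∧
    ∀ g ∈ G, ∀ h ∈ G, ∀ p ∈ terms h, leadingTerm ord g ∣ p → g = h ∧ p = leadingTerm ord g

/-- A reduced standard basis all of whose elements are monomial germs. -/
def IsReducedMonomialStandardBasis (ord : LocalOrder) (I : Ideal SmoothGerm)
    (G : Finset SmoothGerm) : Prop :=
  IsReducedStandardBasis ord I G ∧ ∀ g ∈ G, ∃ e, g = monomialGerm e

/-- The ideal generated by the monomial germs that lie in `I`. -/
def monomialPart (I : Ideal SmoothGerm) : Ideal SmoothGerm :=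
  Ideal.span {p | p ∈ I ∧ ∃ e, p = monomialGerm e}

/-- `I` is generated by monomial germs. -/
def IsMonomialIdeal (I : Ideal SmoothGerm) : Prop :=
  ∃ E : Set (ℕ × ℕ), I = Ideal.span (monomialGerm '' E)

/-! ### Strong equivalence, intrinsic ideals, intrinsic parts -/

/-- `g` and `h` are strongly equivalent: `g(x, l) = S(x, l) * h(X(x, l), l)` near the origin, with
`S` and `X` smooth near the origin, `S > 0`, `X(0, 0) = 0` and `∂X/∂x > 0`. -/
def StronglyEquivalent (g h : SmoothGerm) : Prop :=
  ∃ u v S X : ℝ × ℝ → ℝ,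
    (u : Germ (𝓝 (0 : ℝ × ℝ)) ℝ) = g ∧ (v : Germ (𝓝 (0 : ℝ × ℝ)) ℝ) = h ∧
    SmoothNearZero S ∧ SmoothNearZero X ∧ X 0 = 0 ∧
    (∀ᶠ p in 𝓝 (0 : ℝ × ℝ), 0 < S p ∧ 0 < deriv (fun x => X (x, p.2)) p.1) ∧
    ∀ᶠ p in 𝓝 (0 : ℝ × ℝ), u p = S p * v (X p, p.2)

/-- An ideal is intrinsic when it contains the strong equivalence class of each of its members. -/
def IsIntrinsic (I : Ideal SmoothGerm) : Prop :=
  ∀ h ∈ I, ∀ g, StronglyEquivalent g h → g ∈ I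

/-- The intrinsic part of a vector subspace: the largest intrinsic ideal contained in it. -/
def intrinsicPart (V : Submodule ℝ SmoothGerm) : Ideal SmoothGerm :=
  sSup {J : Ideal SmoothGerm | IsIntrinsic J ∧ (J : Set SmoothGerm) ⊆ V}

/-- The intrinsic part of an ideal, viewed as a vector subspace. -/
def intrinsicPartIdeal (I : Ideal SmoothGerm) : Ideal SmoothGerm :=
  intrinsicPart (I.restrictScalars ℝ)

theorem smoothNearZero_comp {v X : ℝ × ℝ → ℝ} (hv : SmoothNearZero v) (hX : SmoothNearZero X)
    (h0 : X 0 = 0) :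
    Tendsto (fun p : ℝ × ℝ => (X p, p.2)) (𝓝 0) (𝓝 0) ∧
      SmoothNearZero (fun p => v (X p, p.2)) := by
  have hc : ContinuousAt (fun p : ℝ × ℝ => (X p, p.2)) 0 :=
    (hX.self_of_nhds.continuousAt).prodMk continuousAt_snd
  have ht : Tendsto (fun p : ℝ × ℝ => (X p, p.2)) (𝓝 0) (𝓝 0) := by
    have h2 : ((X 0, (0 : ℝ × ℝ).2) : ℝ × ℝ) = 0 := by rw [h0]; rfl
    have h1 := hc.tendsto
    rwa [h2] at h1
  refine ⟨ht, ?_⟩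
  filter_upwards [ht.eventually hv, hX] with p h1 h2
  exact ContDiffAt.comp p h1 (h2.prodMk contDiffAt_snd)

theorem isIntrinsic_sSup (A : Set (Ideal SmoothGerm)) (hA : ∀ J ∈ A, IsIntrinsic J) :
    IsIntrinsic (sSup A) := by
  rintro h hh g ⟨u, v, S, X, hu, hv, hS, hX, hX0, hpos, he⟩
  have key : ∀ k ∈ sSup A, ∀ w : ℝ × ℝ → ℝ, (w : Germ (𝓝 (0 : ℝ × ℝ)) ℝ) = k →
      ∀ g' : SmoothGerm,
        ((fun p => S p * w (X p, p.2) : ℝ × ℝ → ℝ) : Germ (𝓝 (0 : ℝ × ℝ)) ℝ) = g' →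
        g' ∈ sSup A := by
    intro k hk
    rw [sSup_eq_iSup'] at hk
    induction hk using Submodule.iSup_induction' with
    | mem J k hk =>
      intro w hw g' hg'
      exact (le_sSup J.2 : J.1 ≤ sSup A) (hA J.1 J.2 k hk g'
        ⟨_, w, S, X, hg', hw, hS, hX, hX0, hpos, Eventually.of_forall fun _ => rfl⟩)
    | zero =>
      intro w hw g' hg'
      have hw0 : ∀ᶠ p in 𝓝 (0 : ℝ × ℝ), w p = 0 := Germ.coe_eq.1 hw
      have hS0 : SmoothNearZero (0 : ℝ × ℝ → ℝ) := Eventually.of_forall fun _ => contDiffAt_const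
      have ht := (smoothNearZero_comp hS0 hX hX0).1
      have : g' = 0 := by
        apply Subtype.ext
        rw [← hg']
        apply Germ.coe_eq.2
        filter_upwards [ht.eventually hw0] with p hp
        simp [hp]
      rw [this]; exact Submodule.zero_mem _
    | add k₁ k₂ h1 h2 ih1 ih2 =>
      intro w hw g' hg'
      obtain ⟨w₁, hs1, hw1⟩ := k₁.2
      obtain ⟨w₂, hs2, hw2⟩ := k₂.2
      have ht := (smoothNearZero_comp hs1 hX hX0).1
      have hm : ∀ w', SmoothNearZero w' → SmoothNearZero (fun p => S p * w' (X p, p.2)) := by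
        intro w' hw'
        filter_upwards [hS, (smoothNearZero_comp hw' hX hX0).2] with p a b using a.mul b
      have i1 := ih1 w₁ hw1 (germOf _ (hm w₁ hs1)) rfl
      have i2 := ih2 w₂ hw2 (germOf _ (hm w₂ hs2)) rfl
      have hww : ∀ᶠ p in 𝓝 (0 : ℝ × ℝ), w p = w₁ p + w₂ p := by
        apply Germ.coe_eq.1
        rw [hw]
        change k₁.1 + k₂.1 = _
        rw [← hw1, ← hw2]
        rfl
      have : g' = germOf _ (hm w₁ hs1) + germOf _ (hm w₂ hs2) := by
        apply Subtype.ext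
        rw [← hg']
        apply Germ.coe_eq.2
        filter_upwards [ht.eventually hww] with p hp
        simp [hp, mul_add]
      rw [this]
      exact Submodule.add_mem _ i1 i2
  refine key h hh v hv g ?_
  rw [← hu]
  exact (Germ.coe_eq.2 he).symm

/-- The intrinsic part is the largest intrinsic ideal contained in the subspace. -/
theorem intrinsicPart_isGreatest (V : Submodule ℝ SmoothGerm) :
    IsGreatest {J : Ideal SmoothGerm | IsIntrinsic J ∧ (J : Set SmoothGerm) ⊆ V}
      (intrinsicPart V) := by
  refine ⟨⟨isIntrinsic_sSup _ fun J hJ => hJ.1, ?_⟩, fun J hJ => le_sSup hJ⟩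
  intro k hk
  have hk' : k ∈ sSup {J : Ideal SmoothGerm | IsIntrinsic J ∧ (J : Set SmoothGerm) ⊆ V} := hk
  rw [sSup_eq_iSup'] at hk'
  change k ∈ V
  induction hk' using Submodule.iSup_induction' with
  | mem J k hkJ => exact J.2.2 hkJ
  | zero => exact V.zero_mem
  | add k₁ k₂ h1 h2 ih1 ih2 =>
    refine V.add_mem (ih1 ?_) (ih2 ?_) <;> (unfold intrinsicPart; rwa [sSup_eq_iSup'])

/-- `I = ∑ i, 𝓜 ^ m i * ⟨l ^ n i⟩`, where `n i` is strictly increasing and `m i + n i` is strictly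
decreasing. Such an ideal has finite codimension exactly when the first `n i` exists and is `0`;
the empty sum is the zero ideal. -/
def IsIntrinsicPresentation (I : Ideal SmoothGerm) (s : ℕ) (m n : Fin s → ℕ) : Prop :=
  StrictMono n ∧ StrictAnti (fun i => m i + n i) ∧
    I = ⨆ i, maxIdeal ^ m i * Ideal.span {lGerm ^ n i}

/-- The intrinsic generators `x ^ m i * l ^ n i` of `I`. -/
def intrinsicGenerators (I : Ideal SmoothGerm) : Set SmoothGerm :=
  {p | ∃ (s : ℕ) (m n : Fin s → ℕ), IsIntrinsicPresentation I s m n ∧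
    ∃ i, p = monomialGerm (m i, n i)}

end SingularityGerms

end

noncomputable section

namespace SingularityGerms

/-!
By Hadamard's lemma every germ is a constant plus an element of `𝓜 = ⟨x, l⟩`, so modulo `𝓜 ^ k`
every germ is a polynomial. The substitutions `x ↦ c * x + t * l` (`c > 0`) are strong
equivalences. Scaling `x` splits a polynomial in an intrinsic ideal `I ⊇ 𝓜 ^ k` into its parts
`x ^ a * p(l)`, and each `p(l)` is a power of `l` times a unit: so `I` is generated by monomials.
Shearing turns `x ^ (a + 1) * l ^ b ∈ I` into `x ^ a * l ^ (b + 1) ∈ I`: so the monomials in `I` are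
those lying above a staircase in the coordinates `(b, a + b)`, whose corners are the intrinsic
generators. In particular some power of `l` lies in `I` as soon as `I` contains a monomial.
Hadamard's lemma, applied row by row in powers of `l`, then removes from any germ, modulo `I`, all
terms whose exponents are those of monomials in `I`.
-/

universe u

/-! ### Parametric integrals and Hadamard's lemma -/

section ParametricIntegral

variable {H E : Type u} [NormedAddCommGroup H] [NormedSpace ℝ H] [ProperSpace H]
  [NormedAddCommGroup E] [NormedSpace ℝ E] {G : H × ℝ → E}

theorem hasFDerivAt_intervalIntegral_of_contDiff (hG : ContDiff ℝ 1 G) (a b : ℝ) (p : H) :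
    HasFDerivAt (fun p => ∫ t in a..b, G (p, t))
      (∫ t in a..b, (fderiv ℝ G (p, t)).comp (ContinuousLinearMap.inl ℝ H ℝ)) p := by
  have hcont : Continuous fun q : H × ℝ => (fderiv ℝ G q).comp (ContinuousLinearMap.inl ℝ H ℝ) :=
    (hG.continuous_fderiv one_ne_zero).clm_comp continuous_const
  obtain ⟨C, hC⟩ := ((isCompact_closedBall p 1).prod (isCompact_uIcc (a := a) (b := b))
    ).exists_bound_of_continuousOn hcont.continuousOn
  refine intervalIntegral.hasFDerivAt_integral_of_dominated_of_fderiv_le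
    (F := fun p t => G (p, t)) (bound := fun _ => C) (Metric.closedBall_mem_nhds p one_pos)
    (.of_forall fun q => (hG.continuous.comp (.prodMk_right q)).aestronglyMeasurable)
    ((hG.continuous.comp (.prodMk_right p)).intervalIntegrable _ _)
    (hcont.comp (.prodMk_right p)).aestronglyMeasurable
    (.of_forall fun t ht q hq => hC (q, t) ⟨hq, Set.uIoc_subset_uIcc ht⟩)
    intervalIntegrable_const (.of_forall fun t _ q _ => ?_)
  exact (hG.differentiable one_ne_zero (q, t)).hasFDerivAt.comp q (hasFDerivAt_prodMk_left q t)

theorem contDiff_nat_intervalIntegral (n : ℕ) (hG : ContDiff ℝ ∞ G) (a b : ℝ) :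
    ContDiff ℝ n (fun p => ∫ t in a..b, G (p, t)) := by
  have hderiv {F : Type u} [NormedAddCommGroup F] [NormedSpace ℝ F] {K : H × ℝ → F}
      (hK : ContDiff ℝ ∞ K) (p : H) :=
    hasFDerivAt_intervalIntegral_of_contDiff (hK.of_le (by simp)) a b p
  induction n generalizing E with
  | zero =>
    exact contDiff_zero.2 (continuous_iff_continuousAt.2 fun p => (hderiv hG p).continuousAt)
  | succ n ih =>
    push_cast
    refine contDiff_succ_iff_fderiv.2 ⟨fun p => (hderiv hG p).differentiableAt, by simp, ?_⟩
    rw [funext fun p => (hderiv hG p).fderiv]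
    exact ih (G := fun q => (fderiv ℝ G q).comp (ContinuousLinearMap.inl ℝ H ℝ))
      ((hG.fderiv_right (by simp)).clm_comp contDiff_const)

theorem contDiff_intervalIntegral (hG : ContDiff ℝ ∞ G) (a b : ℝ) :
    ContDiff ℝ ∞ (fun p => ∫ t in a..b, G (p, t)) :=
  contDiff_infty.2 fun n => contDiff_nat_intervalIntegral n hG a b

theorem exists_contDiff_hadamard [CompleteSpace E] {f : H → E} (hf : ContDiff ℝ ∞ f) :
    ∃ Q : H × H → H →L[ℝ] E, ContDiff ℝ ∞ Q ∧ ∀ x y, f y = f x + Q (x, y) (y - x) := by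
  have hG : ContDiff ℝ ∞ fun z : (H × H) × ℝ => fderiv ℝ f (z.1.1 + z.2 • (z.1.2 - z.1.1)) :=
    (hf.fderiv_right (m := ∞) (by simp)).comp (by fun_prop)
  refine ⟨_, contDiff_intervalIntegral hG 0 1, fun x y => ?_⟩
  have htaylor := map_add_eq_sum_add_integral_iteratedFDeriv (f := f) (x := x) (y := y - x)
    (n := 0) fun t _ => hf.contDiffAt.of_le (by simp)
  have hint : IntervalIntegrable (fun t : ℝ => fderiv ℝ f (x + t • (y - x)))
      MeasureTheory.volume 0 1 :=
    (hG.continuous.comp (Continuous.prodMk_right (x, y))).intervalIntegrable _ _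
  change f y = f x + (∫ t in (0 : ℝ)..1, fderiv ℝ f (x + t • (y - x))) (y - x)
  rw [ContinuousLinearMap.intervalIntegral_apply hint]
  simpa using htaylor

end ParametricIntegral

namespace SmoothNearZero

variable {f g : ℝ × ℝ → ℝ}

theorem congr (hf : SmoothNearZero f) (h : g =ᶠ[𝓝 0] f) : SmoothNearZero g := by
  filter_upwards [hf, h.eventually_nhds] with p hfp hgp using hfp.congr_of_eventuallyEq hgp

theorem fderiv_apply (hf : SmoothNearZero f) (v : ℝ × ℝ) :
    SmoothNearZero fun p => fderiv ℝ f p v := by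
  filter_upwards [hf] with p hp
  exact (hp.fderiv_right (m := ∞) (by simp)).clm_apply contDiffAt_const

theorem exists_contDiff (hf : SmoothNearZero f) :
    ∃ g : ℝ × ℝ → ℝ, ContDiff ℝ ∞ g ∧ g =ᶠ[𝓝 0] f := by
  obtain ⟨ε, hε, hsmooth⟩ := Metric.eventually_nhds_iff_ball.1 hf
  let χ : ContDiffBump (0 : ℝ × ℝ) := ⟨ε / 3, ε / 2, by positivity, by linarith⟩
  refine ⟨fun p => χ p * f p, contDiff_iff_contDiffAt.2 fun p => ?_, ?_⟩
  · by_cases hp : p ∈ tsupport fun p => χ p * f p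
    · have hpχ : p ∈ tsupport χ := tsupport_mul_subset_left hp
      rw [χ.tsupport_eq] at hpχ
      exact χ.contDiffAt.mul (hsmooth p (Metric.closedBall_subset_ball (half_lt_self hε) hpχ))
    · exact contDiffAt_const.congr_of_eventuallyEq (notMem_tsupport_iff_eventuallyEq.1 hp)
  · filter_upwards [χ.eventuallyEq_one] with p hp
    simp [hp]

theorem exists_hadamard (hf : SmoothNearZero f) :
    ∃ q r : ℝ × ℝ → ℝ, SmoothNearZero q ∧ SmoothNearZero r ∧
      ∀ᶠ p in 𝓝 0, f p = f 0 + (p.1 * q p + p.2 * r p) := by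
  obtain ⟨g, hg, hgf⟩ := hf.exists_contDiff
  obtain ⟨Q, hQ, hgQ⟩ := exists_contDiff_hadamard hg
  have hsmooth (v : ℝ × ℝ) : SmoothNearZero fun p => Q (0, p) v := .of_forall fun p =>
    ((hQ.comp (contDiff_prodMk_right 0)).clm_apply contDiff_const).contDiffAt
  refine ⟨_, _, hsmooth (1, 0), hsmooth (0, 1), ?_⟩
  filter_upwards [hgf] with p hp
  have hsplit : p - 0 = p.1 • ((1, 0) : ℝ × ℝ) + p.2 • ((0, 1) : ℝ × ℝ) := by ext <;> simp
  rw [← hp, ← hgf.self_of_nhds, hgQ 0 p, hsplit, map_add, map_smul, map_smul, smul_eq_mul,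
    smul_eq_mul]

theorem exists_hadamard_snd (hf : SmoothNearZero f) :
    ∃ q : ℝ × ℝ → ℝ, SmoothNearZero q ∧ ∀ᶠ p in 𝓝 0, f p = f (p.1, 0) + p.2 * q p := by
  obtain ⟨g, hg, hgf⟩ := hf.exists_contDiff
  obtain ⟨Q, hQ, hgQ⟩ := exists_contDiff_hadamard hg
  refine ⟨fun p => Q ((p.1, 0), p) (0, 1), .of_forall fun p =>
    ((hQ.comp (by fun_prop)).clm_apply contDiff_const).contDiffAt, ?_⟩
  have hproj : Tendsto (fun p : ℝ × ℝ => (p.1, (0 : ℝ))) (𝓝 0) (𝓝 0) :=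
    Continuous.tendsto' (by fun_prop) _ _ rfl
  filter_upwards [hgf, hproj.eventually hgf] with p hp hp₀
  have hsplit : p - (p.1, 0) = p.2 • ((0, 1) : ℝ × ℝ) := by ext <;> simp
  rw [← hp, ← hp₀, hgQ (p.1, 0) p, hsplit, map_smul, smul_eq_mul]

end SmoothNearZero

/-! ### Evaluation and directional derivatives of germs -/

theorem exists_germOf_eq (g : SmoothGerm) : ∃ f hf, germOf f hf = g := by
  obtain ⟨_, f, hf, rfl⟩ := g
  exact ⟨f, hf, rfl⟩

theorem germOf_eq_germOf_iff {f g : ℝ × ℝ → ℝ} {hf : SmoothNearZero f} {hg : SmoothNearZero g} :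
    germOf f hf = germOf g hg ↔ f =ᶠ[𝓝 0] g :=
  Subtype.ext_iff.trans Germ.coe_eq

/-- Evaluation of germs at the origin, as a homomorphism of `ℝ`-algebras. -/
def evalZero : SmoothGerm →ₐ[ℝ] ℝ where
  __ := (Germ.valueRingHom (x := (0 : ℝ × ℝ))).comp smoothGermSubring.subtype
  commutes' _ := rfl

theorem evalZero_xGerm : evalZero xGerm = 0 := rfl

theorem evalZero_lGerm : evalZero lGerm = 0 := rfl

theorem isUnit_of_evalZero_ne_zero {f : SmoothGerm} (h : evalZero f ≠ 0) : IsUnit f := by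
  obtain ⟨u, hu, rfl⟩ := exists_germOf_eq f
  have hne : ∀ᶠ p in 𝓝 0, u p ≠ 0 := hu.self_of_nhds.continuousAt.eventually_ne h
  have hinv : SmoothNearZero u⁻¹ := by
    filter_upwards [hu, hne] with p hup hp using hup.inv hp
  refine IsUnit.of_mul_eq_one (germOf u⁻¹ hinv) (Subtype.ext (Germ.coe_eq.2 ?_))
  filter_upwards [hne] with p hp using mul_inv_cancel₀ hp

theorem exists_eq_algebraMap_add (f : SmoothGerm) :
    ∃ q r, f = algebraMap ℝ SmoothGerm (evalZero f) + (xGerm * q + lGerm * r) := by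
  obtain ⟨u, hu, rfl⟩ := exists_germOf_eq f
  obtain ⟨q, r, hq, hr, h⟩ := hu.exists_hadamard
  exact ⟨germOf q hq, germOf r hr, Subtype.ext (Germ.coe_eq.2 h)⟩

/-- The derivation of the ring of germs given by the directional derivative along `v`. -/
def germDeriv (v : ℝ × ℝ) : Derivation ℝ SmoothGerm SmoothGerm :=
  Derivation.mk'
    { toFun := fun g => ⟨Germ.map' (fun f p => fderiv ℝ f p v)
          (fun _ _ h => h.fderiv.mono fun _ hp => DFunLike.congr_fun hp v) g.1, by
        obtain ⟨f, hf, rfl⟩ := exists_germOf_eq g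
        exact ⟨_, hf.fderiv_apply v, rfl⟩⟩
      map_add' := fun a b => by
        obtain ⟨f, hf, rfl⟩ := exists_germOf_eq a
        obtain ⟨g, hg, rfl⟩ := exists_germOf_eq b
        refine Subtype.ext (Germ.coe_eq.2 ?_)
        filter_upwards [hf, hg] with p hfp hgp
        exact DFunLike.congr_fun
          (fderiv_add (hfp.differentiableAt (by simp)) (hgp.differentiableAt (by simp))) v
      map_smul' := fun c a => by
        obtain ⟨f, hf, rfl⟩ := exists_germOf_eq a
        refine Subtype.ext (Germ.coe_eq.2 ?_)
        filter_upwards [hf] with p hfp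
        exact DFunLike.congr_fun (fderiv_const_mul (hfp.differentiableAt (by simp)) c) v }
    fun a b => by
      obtain ⟨f, hf, rfl⟩ := exists_germOf_eq a
      obtain ⟨g, hg, rfl⟩ := exists_germOf_eq b
      refine Subtype.ext (Germ.coe_eq.2 ?_)
      filter_upwards [hf, hg] with p hfp hgp
      exact DFunLike.congr_fun
        (fderiv_mul (hfp.differentiableAt (by simp)) (hgp.differentiableAt (by simp))) v

theorem germDeriv_germOf (v : ℝ × ℝ) {f : ℝ × ℝ → ℝ} (hf : SmoothNearZero f) :
    germDeriv v (germOf f hf) = germOf (fun p => fderiv ℝ f p v) (hf.fderiv_apply v) := rfl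

theorem germDeriv_xGerm (v : ℝ × ℝ) : germDeriv v xGerm = algebraMap ℝ SmoothGerm v.1 :=
  Subtype.ext (Germ.coe_eq.2 (.of_forall fun _ => by simp [fderiv_fst]))

theorem germDeriv_lGerm (v : ℝ × ℝ) : germDeriv v lGerm = algebraMap ℝ SmoothGerm v.2 :=
  Subtype.ext (Germ.coe_eq.2 (.of_forall fun _ => by simp [fderiv_snd]))

theorem exists_eq_add_lGerm_mul (f : SmoothGerm) :
    ∃ g q, f = g + lGerm * q ∧ germDeriv (0, 1) g = 0 := by
  obtain ⟨u, hu, rfl⟩ := exists_germOf_eq f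
  obtain ⟨q, hq, h⟩ := hu.exists_hadamard_snd
  have hproj : Tendsto (fun p : ℝ × ℝ => (p.1, (0 : ℝ))) (𝓝 0) (𝓝 0) :=
    Continuous.tendsto' (by fun_prop) _ _ rfl
  have hg : SmoothNearZero fun p => u (p.1, 0) := by
    filter_upwards [hproj.eventually hu] with p hp
    exact hp.comp p (contDiffAt_fst.prodMk contDiffAt_const)
  refine ⟨germOf _ hg, germOf q hq, Subtype.ext (Germ.coe_eq.2 h), Subtype.ext (Germ.coe_eq.2 ?_)⟩
  filter_upwards [hg] with p hp
  have hline := DifferentiableAt.deriv_comp_add_smul (x := p) (y := (0, 1)) (t := (0 : ℝ))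
    (f := fun p : ℝ × ℝ => u (p.1, 0)) (by simpa using hp.differentiableAt (by simp))
  simpa using hline.symm

theorem iterate_germDeriv_germOf (v : ℝ × ℝ) (n : ℕ) {f : ℝ × ℝ → ℝ} (hf : SmoothNearZero f) :
    ∃ h, (germDeriv v)^[n] (germOf f hf) =
      germOf (fun p => iteratedDeriv n (fun t : ℝ => f (p + t • v)) 0) h := by
  induction n generalizing f with
  | zero =>
    have hf₀ : f =ᶠ[𝓝 0] fun p => iteratedDeriv 0 (fun t : ℝ => f (p + t • v)) 0 :=
      .of_forall fun p => by simp
    exact ⟨hf.congr hf₀.symm, germOf_eq_germOf_iff.2 hf₀⟩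
  | succ n ih =>
    obtain ⟨h, hgerm⟩ := ih (hf.fderiv_apply v)
    have hstep : (fun p => iteratedDeriv n (fun t : ℝ => fderiv ℝ f (p + t • v) v) 0) =ᶠ[𝓝 0]
        fun p => iteratedDeriv (n + 1) (fun t : ℝ => f (p + t • v)) 0 := by
      filter_upwards [hf.eventually_nhds] with p hp
      rw [iteratedDeriv_succ']
      refine EventuallyEq.iteratedDeriv_eq _ ?_
      have hline : Tendsto (fun t : ℝ => p + t • v) (𝓝 0) (𝓝 p) :=
        Continuous.tendsto' (by fun_prop) _ _ (by simp)
      filter_upwards [hline.eventually hp] with t ht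
      exact (DifferentiableAt.deriv_comp_add_smul (ht.differentiableAt (by simp))).symm
    refine ⟨h.congr hstep.symm, ?_⟩
    rw [Function.iterate_succ_apply, germDeriv_germOf, hgerm]
    exact germOf_eq_germOf_iff.2 hstep

section IterateDerivation

variable {R A : Type*} [CommSemiring R] [CommSemiring A] [Algebra R A] (D : Derivation R A A)
  {z : A}

theorem iterate_derivation_mul_of_apply_eq_zero (hz : D z = 0) (f : A) (n : ℕ) :
    D^[n] (z * f) = z * D^[n] f := by
  induction n with
  | zero => rfl
  | succ n ih => simp [Function.iterate_succ_apply', ih, D.leibniz, hz]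

theorem iterate_derivation_mul_of_apply_eq_one (hz : D z = 1) (f : A) (n : ℕ) :
    D^[n + 1] (z * f) = z * D^[n + 1] f + (n + 1 : ℕ) * D^[n] f := by
  induction n with
  | zero => simp [D.leibniz, hz]
  | succ n ih =>
    rw [Function.iterate_succ_apply', ih, map_add, D.leibniz, D.leibniz, hz, D.map_natCast,
      Function.iterate_succ_apply' D (n + 1) f, Function.iterate_succ_apply' D n f]
    simp only [smul_eq_mul]
    push_cast
    ring

end IterateDerivation

/-! ### Taylor coefficients -/

theorem taylorCoeff_eq_evalZero (f : SmoothGerm) (e : ℕ × ℕ) :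
    taylorCoeff f e =
      evalZero ((germDeriv (1, 0))^[e.1] ((germDeriv (0, 1))^[e.2] f)) / (e.1 ! * e.2 !) := by
  obtain ⟨u, hu, rfl⟩ := exists_germOf_eq f
  obtain ⟨hl, hl_eq⟩ := iterate_germDeriv_germOf (0, 1) e.2 hu
  obtain ⟨hx, hx_eq⟩ := iterate_germDeriv_germOf (1, 0) e.1 hl
  rw [hl_eq, hx_eq]
  change taylorCoeffFun e u = iteratedDeriv _ _ _ / _
  simp [taylorCoeffFun]

theorem taylorCoeff_add (f g : SmoothGerm) (e : ℕ × ℕ) :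
    taylorCoeff (f + g) e = taylorCoeff f e + taylorCoeff g e := by
  simp only [taylorCoeff_eq_evalZero, iterate_map_add, map_add, add_div]

theorem taylorCoeff_zero (e : ℕ × ℕ) : taylorCoeff 0 e = 0 := by
  simp only [taylorCoeff_eq_evalZero, iterate_map_zero, map_zero, zero_div]

theorem taylorCoeff_smul (c : ℝ) (f : SmoothGerm) (e : ℕ × ℕ) :
    taylorCoeff (c • f) e = c * taylorCoeff f e := by
  simp only [taylorCoeff_eq_evalZero, Algebra.smul_def,
    iterate_derivation_mul_of_apply_eq_zero _ (Derivation.map_algebraMap _ c), map_mul,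
    AlgHom.commutes, Algebra.algebraMap_self_apply, mul_div_assoc]

theorem taylorCoeff_xGerm_mul_succ (f : SmoothGerm) (a b : ℕ) :
    taylorCoeff (xGerm * f) (a + 1, b) = taylorCoeff f (a, b) := by
  have hl : germDeriv (0, 1) xGerm = 0 := by simp [germDeriv_xGerm]
  have hx : germDeriv (1, 0) xGerm = 1 := by simp [germDeriv_xGerm]
  simp only [taylorCoeff_eq_evalZero, iterate_derivation_mul_of_apply_eq_zero _ hl,
    iterate_derivation_mul_of_apply_eq_one _ hx, map_add, map_mul, evalZero_xGerm, zero_mul,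
    zero_add, map_natCast, Nat.factorial_succ, Nat.cast_mul]
  rw [mul_assoc, mul_div_mul_left _ _ (by positivity)]

theorem taylorCoeff_xGerm_mul_zero (f : SmoothGerm) (b : ℕ) :
    taylorCoeff (xGerm * f) (0, b) = 0 := by
  have hl : germDeriv (0, 1) xGerm = 0 := by simp [germDeriv_xGerm]
  simp [taylorCoeff_eq_evalZero, iterate_derivation_mul_of_apply_eq_zero _ hl, evalZero_xGerm]

theorem taylorCoeff_lGerm_mul_succ (f : SmoothGerm) (a b : ℕ) :
    taylorCoeff (lGerm * f) (a, b + 1) = taylorCoeff f (a, b) := by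
  have hx : germDeriv (1, 0) lGerm = 0 := by simp [germDeriv_lGerm]
  have hl : germDeriv (0, 1) lGerm = 1 := by simp [germDeriv_lGerm]
  simp only [taylorCoeff_eq_evalZero, iterate_derivation_mul_of_apply_eq_one _ hl, iterate_map_add,
    iterate_derivation_mul_of_apply_eq_zero _ hx,
    iterate_derivation_mul_of_apply_eq_zero _ (Derivation.map_natCast _ (b + 1)), map_add, map_mul,
    evalZero_lGerm, zero_mul, zero_add, map_natCast, Nat.factorial_succ, Nat.cast_mul]
  rw [mul_left_comm, mul_div_mul_left _ _ (by positivity)]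

theorem taylorCoeff_lGerm_mul_zero (f : SmoothGerm) (a : ℕ) :
    taylorCoeff (lGerm * f) (a, 0) = 0 := by
  have hx : germDeriv (1, 0) lGerm = 0 := by simp [germDeriv_lGerm]
  simp [taylorCoeff_eq_evalZero, iterate_derivation_mul_of_apply_eq_zero _ hx, evalZero_lGerm]

theorem taylorCoeff_succ_eq_zero {f : SmoothGerm} (hf : germDeriv (0, 1) f = 0) (a b : ℕ) :
    taylorCoeff f (a, b + 1) = 0 := by
  simp [taylorCoeff_eq_evalZero, hf]

theorem taylorCoeff_one (e : ℕ × ℕ) : taylorCoeff 1 e = if e = 0 then 1 else 0 := by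
  obtain ⟨_ | a, _ | b⟩ := e <;> simp [taylorCoeff_eq_evalZero]

theorem monomialGerm_zero : monomialGerm 0 = 1 := by simp [monomialGerm]

theorem monomialGerm_add (e e' : ℕ × ℕ) :
    monomialGerm (e + e') = monomialGerm e * monomialGerm e' := by
  simp only [monomialGerm, Prod.fst_add, Prod.snd_add, pow_add]
  ring

theorem taylorCoeff_monomialGerm_mul (e : ℕ × ℕ) (f : SmoothGerm) (e' : ℕ × ℕ) :
    taylorCoeff (monomialGerm e * f) e' = if e ≤ e' then taylorCoeff f (e' - e) else 0 := by
  obtain ⟨a, b⟩ := e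
  induction a generalizing e' with
  | zero =>
    induction b generalizing e' with
    | zero => simp [← Prod.zero_eq_mk, monomialGerm_zero]
    | succ b ih =>
      have hsucc : monomialGerm (0, b + 1) * f = lGerm * (monomialGerm (0, b) * f) := by
        simp only [monomialGerm]; ring
      rw [hsucc]
      obtain ⟨a', _ | b'⟩ := e'
      · simp [taylorCoeff_lGerm_mul_zero]
      · simp [taylorCoeff_lGerm_mul_succ, ih]
  | succ a ih =>
    have hsucc : monomialGerm (a + 1, b) * f = xGerm * (monomialGerm (a, b) * f) := by
      simp only [monomialGerm]; ring
    rw [hsucc]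
    obtain ⟨_ | a', b'⟩ := e'
    · simp [taylorCoeff_xGerm_mul_zero]
    · simp [taylorCoeff_xGerm_mul_succ, ih]

theorem taylorCoeff_monomialGerm (e e' : ℕ × ℕ) :
    taylorCoeff (monomialGerm e) e' = if e' = e then 1 else 0 := by
  rw [← mul_one (monomialGerm e), taylorCoeff_monomialGerm_mul, taylorCoeff_one, ← ite_and]
  exact if_congr (by rw [tsub_eq_zero_iff_le, le_antisymm_iff, and_comm]) rfl rfl

theorem terms_monomialGerm (e : ℕ × ℕ) : terms (monomialGerm e) = {monomialGerm e} := by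
  ext p
  simp [terms, taylorCoeff_monomialGerm]

theorem monomialGerm_dvd_monomialGerm_iff {e e' : ℕ × ℕ} :
    monomialGerm e ∣ monomialGerm e' ↔ e ≤ e' := by
  constructor
  · rintro ⟨f, hf⟩
    have hcoeff := taylorCoeff_monomialGerm e' e'
    rw [hf, taylorCoeff_monomialGerm_mul] at hcoeff
    by_contra hle
    simp [hle] at hcoeff
  · rintro hle
    obtain ⟨d, rfl⟩ := exists_add_of_le hle
    exact ⟨_, monomialGerm_add e d⟩

/-! ### Ideals generated by monomials -/

/-- The exponents of the monomial germs in an ideal. -/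
def exponents (I : Ideal SmoothGerm) : Set (ℕ × ℕ) := {e | monomialGerm e ∈ I}

theorem isUpperSet_exponents (I : Ideal SmoothGerm) : IsUpperSet (exponents I) :=
  fun _ _ hle he => I.mem_of_dvd (monomialGerm_dvd_monomialGerm_iff.2 hle) he

theorem exists_le_of_mem_span_of_taylorCoeff_ne_zero {E : Set (ℕ × ℕ)} {f : SmoothGerm}
    (hf : f ∈ Ideal.span (monomialGerm '' E)) {e : ℕ × ℕ} (he : taylorCoeff f e ≠ 0) :
    ∃ e₀ ∈ E, e₀ ≤ e := by
  induction hf using Submodule.closure_induction with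
  | zero => exact absurd (taylorCoeff_zero e) he
  | add f g _ _ ihf ihg =>
    by_cases hfe : taylorCoeff f e = 0
    · exact ihg fun hge => he (by rw [taylorCoeff_add, hfe, hge, add_zero])
    · exact ihf hfe
  | smul_mem r _ h =>
    obtain ⟨e₀, he₀, rfl⟩ := h
    rw [smul_eq_mul, mul_comm, taylorCoeff_monomialGerm_mul] at he
    exact ⟨e₀, he₀, of_not_not fun hle => he (if_neg hle)⟩

theorem monomialGerm_mem_span_iff {E : Set (ℕ × ℕ)} {e : ℕ × ℕ} :
    monomialGerm e ∈ Ideal.span (monomialGerm '' E) ↔ ∃ e₀ ∈ E, e₀ ≤ e := by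
  constructor
  · exact fun h =>
      exists_le_of_mem_span_of_taylorCoeff_ne_zero h (by simp [taylorCoeff_monomialGerm])
  · rintro ⟨e₀, he₀, hle⟩
    exact isUpperSet_exponents (Ideal.span _) hle (Ideal.subset_span ⟨e₀, he₀, rfl⟩)

theorem monomialPart_eq_span (I : Ideal SmoothGerm) :
    monomialPart I = Ideal.span (monomialGerm '' exponents I) := by
  unfold monomialPart
  congr 1
  ext p
  constructor
  · rintro ⟨he, e, rfl⟩
    exact ⟨e, he, rfl⟩
  · rintro ⟨e, he, rfl⟩
    exact ⟨he, e, rfl⟩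

theorem monomialPart_le (I : Ideal SmoothGerm) : monomialPart I ≤ I :=
  Ideal.span_le.2 fun _ h => h.1

theorem IsMonomialIdeal.monomialPart_eq {I : Ideal SmoothGerm} (hI : IsMonomialIdeal I) :
    monomialPart I = I := by
  obtain ⟨E, rfl⟩ := hI
  refine (monomialPart_le _).antisymm (Ideal.span_mono ?_)
  rintro _ ⟨e, he, rfl⟩
  exact ⟨Ideal.subset_span ⟨e, he, rfl⟩, e, rfl⟩

theorem IsMonomialIdeal.eq_span_exponents {I : Ideal SmoothGerm} (hI : IsMonomialIdeal I) :
    I = Ideal.span (monomialGerm '' exponents I) := by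
  rw [← monomialPart_eq_span, hI.monomialPart_eq]

theorem smul_monomialGerm_mem_iff {I : Ideal SmoothGerm} {c : ℝ} (hc : c ≠ 0) {e : ℕ × ℕ} :
    c • monomialGerm e ∈ I ↔ e ∈ exponents I :=
  Submodule.smul_mem_iff I hc

theorem IsMonomialIdeal.terms_subset {I : Ideal SmoothGerm} (hI : IsMonomialIdeal I)
    {f : SmoothGerm} (hf : f ∈ I) : terms f ⊆ I := by
  rintro _ ⟨e, he, rfl⟩
  rw [hI.eq_span_exponents] at hf
  obtain ⟨e₀, he₀, hle⟩ := exists_le_of_mem_span_of_taylorCoeff_ne_zero hf he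
  exact (smul_monomialGerm_mem_iff he).2 (isUpperSet_exponents I hle he₀)

/-! ### Leading terms and reduced monomial standard bases -/

section LeadingTerm

variable {ord : LocalOrder} {f : SmoothGerm} {e : ℕ × ℕ}

theorem IsLeadingExponent.unique {e' : ℕ × ℕ} (he : IsLeadingExponent ord f e)
    (he' : IsLeadingExponent ord f e') : e = e' := by
  by_contra hne
  have := ord.strictTotal
  exact asymm (he.2 e' he'.1 (Ne.symm hne)) (he'.2 e he.1 hne)

theorem IsLeadingExponent.leadingTerm_eq (he : IsLeadingExponent ord f e) :
    leadingTerm ord f = taylorCoeff f e • monomialGerm e := by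
  have hex : ∃ e, IsLeadingExponent ord f e := ⟨e, he⟩
  rw [leadingTerm, dif_pos hex, hex.choose_spec.unique he]

theorem IsLeadingExponent.leadingCoeff_eq (he : IsLeadingExponent ord f e) :
    leadingCoeff ord f = taylorCoeff f e := by
  have hex : ∃ e, IsLeadingExponent ord f e := ⟨e, he⟩
  rw [leadingCoeff, dif_pos hex, hex.choose_spec.unique he]

theorem leadingTerm_eq_zero_or_mem_terms (ord : LocalOrder) (f : SmoothGerm) :
    leadingTerm ord f = 0 ∨ leadingTerm ord f ∈ terms f := by
  unfold leadingTerm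
  split_ifs with h
  · exact .inr ⟨_, h.choose_spec.1, rfl⟩
  · exact .inl rfl

theorem isLeadingExponent_monomialGerm (ord : LocalOrder) (e : ℕ × ℕ) :
    IsLeadingExponent ord (monomialGerm e) e :=
  ⟨by simp [taylorCoeff_monomialGerm],
    fun e' he' hne => by simp [taylorCoeff_monomialGerm, hne] at he'⟩

theorem leadingTerm_monomialGerm (ord : LocalOrder) (e : ℕ × ℕ) :
    leadingTerm ord (monomialGerm e) = monomialGerm e := by
  simp [(isLeadingExponent_monomialGerm ord e).leadingTerm_eq, taylorCoeff_monomialGerm]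

theorem leadingCoeff_monomialGerm (ord : LocalOrder) (e : ℕ × ℕ) :
    leadingCoeff ord (monomialGerm e) = 1 := by
  simp [(isLeadingExponent_monomialGerm ord e).leadingCoeff_eq, taylorCoeff_monomialGerm]

theorem IsMonomialIdeal.leadingTermIdeal_eq {I : Ideal SmoothGerm} (hI : IsMonomialIdeal I)
    (ord : LocalOrder) : leadingTermIdeal ord I = I := by
  refine le_antisymm (Ideal.span_le.2 ?_) ?_
  · rintro _ ⟨f, hf, rfl⟩
    rcases leadingTerm_eq_zero_or_mem_terms ord f with h | h
    · exact h ▸ I.zero_mem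
    · exact hI.terms_subset hf h
  · conv_lhs => rw [hI.eq_span_exponents]
    refine Ideal.span_mono ?_
    rintro _ ⟨e, he, rfl⟩
    exact ⟨monomialGerm e, he, leadingTerm_monomialGerm ord e⟩

end LeadingTerm

/-- The monomial germs whose exponents are minimal in `E`; by Dickson's lemma there are finitely
many of them. -/
def minimalMonomials (E : Set (ℕ × ℕ)) : Finset SmoothGerm :=
  ((WellQuasiOrderedLE.finite_of_isAntichain (setOfPred_minimal_antichain (· ∈ E))).image
    monomialGerm).toFinset

theorem mem_minimalMonomials {E : Set (ℕ × ℕ)} {p : SmoothGerm} :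
    p ∈ minimalMonomials E ↔ ∃ e, Minimal (· ∈ E) e ∧ monomialGerm e = p := by
  simp [minimalMonomials]

theorem span_minimalMonomials (E : Set (ℕ × ℕ)) :
    Ideal.span (minimalMonomials E : Set SmoothGerm) = Ideal.span (monomialGerm '' E) := by
  refine le_antisymm (Ideal.span_mono ?_) (Ideal.span_le.2 ?_)
  · intro p hp
    obtain ⟨e, he, rfl⟩ := mem_minimalMonomials.1 hp
    exact ⟨e, he.1, rfl⟩
  · rintro _ ⟨e, he, rfl⟩
    obtain ⟨e₀, hle, he₀⟩ := exists_minimal_le_of_wellFoundedLT (· ∈ E) e he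
    exact isUpperSet_exponents (Ideal.span _) hle
      (Ideal.subset_span (mem_minimalMonomials.2 ⟨e₀, he₀, rfl⟩))

theorem isStandardBasis_minimalMonomials (ord : LocalOrder) (E : Set (ℕ × ℕ)) :
    IsStandardBasis ord (Ideal.span (monomialGerm '' E)) (minimalMonomials E) := by
  refine ⟨span_minimalMonomials E, ?_⟩
  have himage : leadingTerm ord '' (minimalMonomials E : Set SmoothGerm) = minimalMonomials E := by
    refine (Set.image_congr fun g hg => ?_).trans (Set.image_id' _)
    obtain ⟨e, -, rfl⟩ := mem_minimalMonomials.1 hg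
    exact leadingTerm_monomialGerm ord e
  rw [himage, span_minimalMonomials, IsMonomialIdeal.leadingTermIdeal_eq ⟨E, rfl⟩]

theorem isReducedMonomialStandardBasis_minimalMonomials (ord : LocalOrder) (E : Set (ℕ × ℕ)) :
    IsReducedMonomialStandardBasis ord (Ideal.span (monomialGerm '' E)) (minimalMonomials E) := by
  refine ⟨⟨isStandardBasis_minimalMonomials ord E, ?_, ?_⟩, ?_⟩
  · intro g hg
    obtain ⟨e, -, rfl⟩ := mem_minimalMonomials.1 hg
    exact leadingCoeff_monomialGerm ord e
  · intro g hg h hh p hp hdvd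
    obtain ⟨e, he, rfl⟩ := mem_minimalMonomials.1 hg
    obtain ⟨e', he', rfl⟩ := mem_minimalMonomials.1 hh
    rw [terms_monomialGerm, Set.mem_singleton_iff] at hp
    rw [hp, leadingTerm_monomialGerm] at hdvd ⊢
    obtain rfl := he'.eq_of_le he.1 (monomialGerm_dvd_monomialGerm_iff.1 hdvd)
    exact ⟨rfl, rfl⟩
  · intro g hg
    obtain ⟨e, -, rfl⟩ := mem_minimalMonomials.1 hg
    exact ⟨e, rfl⟩

theorem isReducedMonomialStandardBasis_monomialPart (ord : LocalOrder) (I : Ideal SmoothGerm) :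
    IsReducedMonomialStandardBasis ord (monomialPart I) (minimalMonomials (exponents I)) := by
  rw [monomialPart_eq_span]
  exact isReducedMonomialStandardBasis_minimalMonomials ord _

theorem IsMonomialIdeal.isReducedMonomialStandardBasis {I : Ideal SmoothGerm}
    (hI : IsMonomialIdeal I) (ord : LocalOrder) :
    IsReducedMonomialStandardBasis ord I (minimalMonomials (exponents I)) := by
  simpa only [hI.monomialPart_eq] using isReducedMonomialStandardBasis_monomialPart ord I

/-! ### Powers of the maximal ideal -/

theorem xGerm_mem_maxIdeal : xGerm ∈ maxIdeal := Ideal.subset_span (.inl rfl)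

theorem lGerm_mem_maxIdeal : lGerm ∈ maxIdeal := Ideal.subset_span (.inr rfl)

theorem mem_maxIdeal_of_evalZero_eq_zero {f : SmoothGerm} (hf : evalZero f = 0) :
    f ∈ maxIdeal := by
  obtain ⟨q, r, h⟩ := exists_eq_algebraMap_add f
  rw [h, hf, map_zero, zero_add]
  exact add_mem (Ideal.mul_mem_right _ _ xGerm_mem_maxIdeal)
    (Ideal.mul_mem_right _ _ lGerm_mem_maxIdeal)

theorem monomialGerm_mem_maxIdeal_pow {e : ℕ × ℕ} {k : ℕ} (h : k ≤ e.1 + e.2) :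
    monomialGerm e ∈ maxIdeal ^ k := by
  refine Ideal.pow_le_pow_right h ?_
  rw [pow_add]
  exact Ideal.mul_mem_mul (Ideal.pow_mem_pow xGerm_mem_maxIdeal _)
    (Ideal.pow_mem_pow lGerm_mem_maxIdeal _)

theorem maxIdeal_eq_span_monomialGerm :
    maxIdeal = Ideal.span (monomialGerm '' {(1, 0), (0, 1)}) := by
  simp [maxIdeal, Set.image_pair, monomialGerm]

theorem maxIdeal_pow_eq_span (k : ℕ) :
    maxIdeal ^ k = Ideal.span (monomialGerm '' {e | k ≤ e.1 + e.2}) := by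
  refine le_antisymm ?_ (Ideal.span_le.2 ?_)
  · induction k with
    | zero =>
      have hone : (1 : SmoothGerm) ∈ Ideal.span (monomialGerm '' {e | 0 ≤ e.1 + e.2}) :=
        Ideal.subset_span ⟨0, Nat.zero_le _, monomialGerm_zero⟩
      exact le_top.trans_eq ((Ideal.eq_top_iff_one _).2 hone).symm
    | succ k ih =>
      refine (pow_succ maxIdeal k).trans_le ((Ideal.mul_mono_left ih).trans ?_)
      rw [maxIdeal_eq_span_monomialGerm, Ideal.span_mul_span', Ideal.span_le]
      rintro _ ⟨_, ⟨e, he, rfl⟩, _, ⟨d, hd, rfl⟩, rfl⟩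
      refine Ideal.subset_span ⟨e + d, ?_, monomialGerm_add e d⟩
      have hd' : d.1 + d.2 = 1 := by rcases hd with rfl | rfl <;> rfl
      simp only [Set.mem_ofPred_eq, Prod.fst_add, Prod.snd_add] at he ⊢
      omega
  · rintro _ ⟨e, he, rfl⟩
    exact monomialGerm_mem_maxIdeal_pow he

theorem maxIdeal_pow_mul_span_eq_span (m n : ℕ) :
    maxIdeal ^ m * Ideal.span {lGerm ^ n} =
      Ideal.span (monomialGerm '' {e | n ≤ e.2 ∧ m + n ≤ e.1 + e.2}) := by
  have hl : {lGerm ^ n} = monomialGerm '' {(0, n)} := by simp [monomialGerm]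
  rw [maxIdeal_pow_eq_span, hl, Ideal.span_mul_span']
  congr 1
  ext p
  constructor
  · rintro ⟨_, ⟨e, he, rfl⟩, _, ⟨_, rfl, rfl⟩, rfl⟩
    refine ⟨e + (0, n), ?_, monomialGerm_add e (0, n)⟩
    simp only [Set.mem_ofPred_eq, Prod.fst_add, Prod.snd_add] at he ⊢
    omega
  · rintro ⟨⟨a, b⟩, ⟨hn, hmn⟩, rfl⟩
    obtain ⟨b, rfl⟩ := Nat.exists_eq_add_of_le' hn
    refine ⟨_, ⟨(a, b), ?_, rfl⟩, _, ⟨_, rfl, rfl⟩, (monomialGerm_add (a, b) (0, n)).symm⟩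
    simp only [Set.mem_ofPred_eq] at hmn ⊢
    omega

theorem span_monomialGerm_sup_maxIdeal_pow_eq_top (k : ℕ) :
    Submodule.span ℝ (monomialGerm '' {e | e.1 + e.2 < k}) ⊔ (maxIdeal ^ k).restrictScalars ℝ =
      ⊤ := by
  induction k with
  | zero => simp
  | succ k ih =>
    rw [eq_top_iff, ← ih]
    refine sup_le (le_sup_of_le_left (Submodule.span_mono (Set.image_mono fun e he => ?_))) ?_
    · exact Nat.lt_succ_of_lt he
    intro f hf
    rw [Submodule.restrictScalars_mem, maxIdeal_pow_eq_span] at hf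
    induction hf using Submodule.closure_induction with
    | zero => exact zero_mem _
    | add f g _ _ hf hg => exact add_mem hf hg
    | smul_mem r _ h =>
      obtain ⟨e, he, rfl⟩ := h
      have hsplit : r • monomialGerm e =
          evalZero r • monomialGerm e +
            (r - algebraMap ℝ SmoothGerm (evalZero r)) * monomialGerm e := by
        rw [smul_eq_mul, Algebra.smul_def]
        ring
      rw [hsplit]
      refine add_mem (Submodule.smul_mem _ _ ?_) (Submodule.mem_sup_right ?_)
      · by_cases hlt : e.1 + e.2 < k + 1
        · exact Submodule.mem_sup_left (Submodule.subset_span ⟨e, hlt, rfl⟩)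
        · exact Submodule.mem_sup_right (monomialGerm_mem_maxIdeal_pow (not_lt.1 hlt))
      · rw [Submodule.restrictScalars_mem, pow_succ']
        exact Ideal.mul_mem_mul (mem_maxIdeal_of_evalZero_eq_zero (by simp))
          (monomialGerm_mem_maxIdeal_pow he)

theorem aevalAeval_eq_sum_range {R A : Type*} [CommSemiring R] [CommSemiring A] [Algebra R A]
    (x y : A) (P : Polynomial (Polynomial R)) :
    Polynomial.aevalAeval x y P =
      ∑ a ∈ Finset.range (P.natDegree + 1), y ^ a * Polynomial.aeval x (P.coeff a) := by
  conv_lhs => rw [P.as_sum_range_C_mul_X_pow, map_sum]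
  simp only [map_mul, map_pow, Polynomial.aevalAeval_C, Polynomial.aevalAeval_Y, mul_comm]

theorem exists_polynomial_sub_mem_maxIdeal_pow (k : ℕ) (f : SmoothGerm) :
    ∃ P : Polynomial (Polynomial ℝ),
      f - Polynomial.aevalAeval lGerm xGerm P ∈ maxIdeal ^ k := by
  have hspan : Submodule.span ℝ (monomialGerm '' {e | e.1 + e.2 < k}) ≤
      (Polynomial.aevalAeval (R := ℝ) lGerm xGerm).range.toSubmodule := by
    refine Submodule.span_le.2 ?_
    rintro _ ⟨e, -, rfl⟩
    exact ⟨.X ^ e.1 * .C .X ^ e.2, by simp [monomialGerm]⟩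
  obtain ⟨p, hp, q, hq, rfl⟩ := Submodule.mem_sup.1
    ((span_monomialGerm_sup_maxIdeal_pow_eq_top k).ge (Submodule.mem_top (x := f)))
  obtain ⟨P, rfl⟩ := hspan hp
  exact ⟨P, by simpa using hq⟩

/-! ### Substitutions -/

/-- The substitution `f(x, l) ↦ f(X(x, l), l)`, as an endomorphism of the algebra of germs. -/
def substHom (X : ℝ × ℝ → ℝ) (hX : SmoothNearZero X) (h0 : X 0 = 0) :
    SmoothGerm →ₐ[ℝ] SmoothGerm where
  toFun f := ⟨Germ.compTendsto f.1 (fun p => (X p, p.2)) (smoothNearZero_comp hX hX h0).1, by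
    obtain ⟨_, u, hu, rfl⟩ := f
    exact ⟨_, (smoothNearZero_comp hu hX h0).2, rfl⟩⟩
  map_one' := rfl
  map_zero' := rfl
  map_mul' f g := by
    obtain ⟨_, _, rfl⟩ := exists_germOf_eq f
    obtain ⟨_, _, rfl⟩ := exists_germOf_eq g
    rfl
  map_add' f g := by
    obtain ⟨_, _, rfl⟩ := exists_germOf_eq f
    obtain ⟨_, _, rfl⟩ := exists_germOf_eq g
    rfl
  commutes' _ := rfl

theorem isIntrinsic_iff {I : Ideal SmoothGerm} :
    IsIntrinsic I ↔ ∀ X hX h0, (∀ᶠ p in 𝓝 (0 : ℝ × ℝ), 0 < deriv (fun x => X (x, p.2)) p.1) →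
      ∀ f ∈ I, substHom X hX h0 f ∈ I := by
  constructor
  · intro hI X hX h0 hpos f hf
    obtain ⟨u, hu, rfl⟩ := exists_germOf_eq f
    exact hI _ hf _ ⟨_, u, fun _ => 1, X, rfl, rfl, .of_forall fun _ => contDiffAt_const, hX, h0,
      hpos.mono fun _ hp => ⟨one_pos, hp⟩, .of_forall fun _ => (one_mul _).symm⟩
  · rintro hI f hf _ ⟨v, u, S, X, hv, hu, hS, hX, h0, hpos, heq⟩
    obtain ⟨w, hw, rfl⟩ := exists_germOf_eq f
    refine (congrArg (· ∈ I) (Subtype.ext ?_)).mpr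
      (I.mul_mem_left (germOf S hS) (hI X hX h0 (hpos.mono fun _ hp => hp.2) _ hf))
    rw [← hv]
    refine Germ.coe_eq.2 ?_
    filter_upwards [heq, (smoothNearZero_comp hw hX h0).1.eventually (Germ.coe_eq.1 hu)]
      with p hvp hup
    exact hvp.trans (congrArg (S p * ·) hup)

/-- The linear substitution `f(x, l) ↦ f(a x + b l, l)`. -/
def linearSubst (a b : ℝ) : SmoothGerm →ₐ[ℝ] SmoothGerm :=
  substHom (fun p => a * p.1 + b * p.2) (.of_forall fun _ => by fun_prop) (by simp)

theorem linearSubst_xGerm (a b : ℝ) : linearSubst a b xGerm = a • xGerm + b • lGerm := rfl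

theorem linearSubst_lGerm (a b : ℝ) : linearSubst a b lGerm = lGerm := rfl

theorem linearSubst_aeval_lGerm (a b : ℝ) (p : Polynomial ℝ) :
    linearSubst a b (Polynomial.aeval lGerm p) = Polynomial.aeval lGerm p := by
  rw [← Polynomial.aeval_algHom_apply, linearSubst_lGerm]

theorem IsIntrinsic.linearSubst_mem {I : Ideal SmoothGerm} (hI : IsIntrinsic I) {a : ℝ}
    (ha : 0 < a) (b : ℝ) {f : SmoothGerm} (hf : f ∈ I) : linearSubst a b f ∈ I :=
  isIntrinsic_iff.1 hI _ _ _ (.of_forall fun _ => by simpa using ha) f hf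

theorem isIntrinsic_maxIdeal_pow (k : ℕ) : IsIntrinsic (maxIdeal ^ k) := by
  refine isIntrinsic_iff.2 fun X hX h0 _ f hf => ?_
  have hmap : maxIdeal.map (substHom X hX h0) ≤ maxIdeal := by
    rw [maxIdeal, Ideal.map_span, Ideal.span_le]
    rintro _ ⟨z, rfl | rfl, rfl⟩
    · exact mem_maxIdeal_of_evalZero_eq_zero h0
    · exact lGerm_mem_maxIdeal
  have hmem := Ideal.mem_map_of_mem (substHom X hX h0) hf
  rw [Ideal.map_pow] at hmem
  exact Ideal.pow_right_mono hmap k hmem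

/-! ### Intrinsic ideals and their monomials -/

theorem mem_of_forall_sum_pow_smul_mem {K M : Type*} [Field K] [AddCommGroup M] [Module K M]
    {S : Set K} (hS : S.Infinite) {W : Submodule K M} {n : ℕ} {v : ℕ → M}
    (h : ∀ c ∈ S, ∑ i ∈ Finset.range n, c ^ i • v i ∈ W) {j : ℕ} (hj : j < n) : v j ∈ W := by
  let c (i : Fin n) : K := hS.natEmbedding S i
  have hc : Function.Injective c :=
    Subtype.val_injective.comp ((hS.natEmbedding S).injective.comp Fin.val_injective)
  let A := Matrix.vandermonde c
  have hA : IsUnit A.det := (Matrix.det_vandermonde_ne_zero_iff.2 hc).isUnit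
  have hrow (i : Fin n) : ∑ k, A i k • v k ∈ W := by
    have := h (c i) (hS.natEmbedding S i).2
    rwa [Finset.sum_range] at this
  have hinv : ∑ i, A⁻¹ ⟨j, hj⟩ i • ∑ k, A i k • v k = v j := by
    simp_rw [Finset.smul_sum, smul_smul]
    rw [Finset.sum_comm]
    simp [← Finset.sum_smul, ← Matrix.mul_apply, Matrix.nonsing_inv_mul A hA, Matrix.one_apply]
  exact hinv ▸ sum_mem fun i _ => W.smul_mem _ (hrow i)

theorem linearSubst_monomialGerm (c : ℝ) (a b : ℕ) :
    linearSubst 1 c (monomialGerm (a, b)) = ∑ i ∈ Finset.range (a + 1),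
      c ^ i • ((a.choose i : ℝ) • monomialGerm (a - i, b + i)) := by
  simp only [monomialGerm, map_mul, map_pow, linearSubst_xGerm, linearSubst_lGerm, one_smul]
  rw [add_comm, add_pow, Finset.sum_mul]
  refine Finset.sum_congr rfl fun i _ => ?_
  simp only [Algebra.smul_def, map_pow, map_natCast]
  ring

theorem IsIntrinsic.monomialGerm_sub_add_mem {I : Ideal SmoothGerm} (hI : IsIntrinsic I)
    {a b : ℕ} (h : monomialGerm (a, b) ∈ I) {i : ℕ} (hi : i ≤ a) :
    monomialGerm (a - i, b + i) ∈ I := by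
  have hsum (c : ℝ) : ∑ i ∈ Finset.range (a + 1),
      c ^ i • ((a.choose i : ℝ) • monomialGerm (a - i, b + i)) ∈ I.restrictScalars ℝ :=
    linearSubst_monomialGerm c a b ▸ hI.linearSubst_mem one_pos c h
  have hmem := mem_of_forall_sum_pow_smul_mem Set.infinite_univ (fun c _ => hsum c)
    (Nat.lt_succ_of_le hi)
  exact (smul_monomialGerm_mem_iff (Nat.cast_ne_zero.2 (Nat.choose_pos hi).ne')).1 hmem

theorem IsIntrinsic.monomialGerm_mem {I : Ideal SmoothGerm} (hI : IsIntrinsic I) {e e' : ℕ × ℕ}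
    (h : monomialGerm e ∈ I) (hsnd : e.2 ≤ e'.2) (hdeg : e.1 + e.2 ≤ e'.1 + e'.2) :
    monomialGerm e' ∈ I := by
  refine isUpperSet_exponents I ?_ (hI.monomialGerm_sub_add_mem h (Nat.sub_le e.1 e'.1))
  exact ⟨by simp only; omega, by simp only; omega⟩

theorem IsIntrinsic.xGerm_pow_mul_aeval_mem {I : Ideal SmoothGerm} (hI : IsIntrinsic I)
    {P : Polynomial (Polynomial ℝ)} (hP : Polynomial.aevalAeval lGerm xGerm P ∈ I) (a : ℕ) :
    xGerm ^ a * Polynomial.aeval lGerm (P.coeff a) ∈ I := by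
  rcases lt_or_ge P.natDegree a with ha | ha
  · simp [P.coeff_eq_zero_of_natDegree_lt ha]
  refine mem_of_forall_sum_pow_smul_mem (W := I.restrictScalars ℝ) (Set.Ioi_infinite (0 : ℝ))
    (v := fun a => xGerm ^ a * Polynomial.aeval lGerm (P.coeff a)) (fun c hc => ?_)
    (Nat.lt_add_one_of_le ha)
  have hmem := hI.linearSubst_mem hc 0 hP
  rw [aevalAeval_eq_sum_range, map_sum] at hmem
  simpa only [map_mul, map_pow, linearSubst_xGerm, zero_smul, add_zero, linearSubst_aeval_lGerm,
    smul_pow, smul_mul_assoc, Submodule.restrictScalars_mem] using hmem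

theorem exists_isUnit_aeval_lGerm_eq {p : Polynomial ℝ} (hp : p ≠ 0) :
    ∃ n u, IsUnit u ∧ Polynomial.aeval lGerm p = lGerm ^ n * u := by
  obtain ⟨q, hq, hdvd⟩ := Polynomial.exists_eq_pow_rootMultiplicity_mul_and_not_dvd p hp 0
  rw [map_zero, sub_zero] at hq hdvd
  refine ⟨_, Polynomial.aeval lGerm q, isUnit_of_evalZero_ne_zero ?_,
    by conv_lhs => rw [hq, map_mul, map_pow, Polynomial.aeval_X]⟩
  rwa [← Polynomial.aeval_algHom_apply, evalZero_lGerm, ← Polynomial.coeff_zero_eq_aeval_zero,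
    ne_eq, ← Polynomial.X_dvd_iff]

theorem xGerm_pow_mul_aeval_mem_monomialPart {I : Ideal SmoothGerm} {a : ℕ} {p : Polynomial ℝ}
    (h : xGerm ^ a * Polynomial.aeval lGerm p ∈ I) :
    xGerm ^ a * Polynomial.aeval lGerm p ∈ monomialPart I := by
  rcases eq_or_ne p 0 with rfl | hp
  · simp
  obtain ⟨n, u, hu, hp⟩ := exists_isUnit_aeval_lGerm_eq hp
  rw [hp, ← mul_assoc, Ideal.mul_unit_mem_iff_mem _ hu] at h ⊢
  exact Ideal.subset_span ⟨h, (a, n), rfl⟩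

theorem IsIntrinsic.isMonomialIdeal {I : Ideal SmoothGerm} (hI : IsIntrinsic I)
    (hfin : HasFiniteCodim (I.restrictScalars ℝ)) : IsMonomialIdeal I := by
  obtain ⟨k, hk : maxIdeal ^ k ≤ I⟩ := hfin
  have hk' : maxIdeal ^ k ≤ monomialPart I := by
    rw [monomialPart_eq_span, maxIdeal_pow_eq_span]
    refine Ideal.span_mono (Set.image_mono fun e he => hk (monomialGerm_mem_maxIdeal_pow he))
  refine ⟨exponents I, le_antisymm (fun f hf => ?_) ?_⟩
  · rw [← monomialPart_eq_span]
    obtain ⟨P, hP⟩ := exists_polynomial_sub_mem_maxIdeal_pow k f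
    refine ((monomialPart I).sub_mem_iff_left ?_).1 (hk' hP)
    have hPI : Polynomial.aevalAeval lGerm xGerm P ∈ I :=
      (I.sub_mem_iff_right hf).1 (hk hP)
    have hterm (a : ℕ) := xGerm_pow_mul_aeval_mem_monomialPart (hI.xGerm_pow_mul_aeval_mem hPI a)
    rw [aevalAeval_eq_sum_range]
    exact sum_mem fun a _ => hterm a
  · exact (monomialPart_eq_span I).ge.trans (monomialPart_le I)

/-! ### Intrinsic presentations -/

theorem exists_strictMono_strictAnti_range_eq {α β : Type*} [LinearOrder α] [LinearOrder β]
    {s : Set (α × β)} (hfin : s.Finite) (hs : IsAntichain (· ≤ ·) s) :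
    ∃ (k : ℕ) (f : Fin k → α) (g : Fin k → β),
      StrictMono f ∧ StrictAnti g ∧ Set.range (fun i => (f i, g i)) = s := by
  let S : Finset (α ×ₗ β) := hfin.toFinset.map toLex.toEmbedding
  let p : Fin S.card → α × β := ofLex ∘ S.orderEmbOfFin rfl
  have hrange : Set.range p = s := by
    rw [Set.range_comp, S.range_orderEmbOfFin]
    simp [S, Set.image_image]
  have hp (i : Fin S.card) : p i ∈ s := hrange ▸ Set.mem_range_self i
  have hstairs {i j : Fin S.card} (hij : i < j) : (p i).1 < (p j).1 ∧ (p j).2 < (p i).2 := by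
    have hlex := (S.orderEmbOfFin rfl).strictMono hij
    have hne : p i ≠ p j := fun h => hlex.ne (ofLex_inj.1 h)
    have hnle : ¬ p i ≤ p j := hs (hp i) (hp j) hne
    rcases Prod.Lex.lt_iff.1 hlex with hlt | ⟨heq, hlt⟩
    · exact ⟨hlt, lt_of_not_ge fun hle => hnle ⟨hlt.le, hle⟩⟩
    · exact absurd ⟨heq.le, hlt.le⟩ hnle
  exact ⟨S.card, fun i => (p i).1, fun i => (p i).2, fun _ _ hij => (hstairs hij).1,
    fun _ _ hij => (hstairs hij).2, hrange⟩

theorem iSup_maxIdeal_pow_mul_span {ι : Type*} (m n : ι → ℕ) :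
    ⨆ i, maxIdeal ^ m i * Ideal.span {lGerm ^ n i} =
      Ideal.span (monomialGerm '' {e | ∃ i, n i ≤ e.2 ∧ m i + n i ≤ e.1 + e.2}) := by
  simp only [maxIdeal_pow_mul_span_eq_span, ← Ideal.span_iUnion, ← Set.image_iUnion,
    Set.iUnion_ofPred]

theorem IsIntrinsicPresentation.mem_exponents_iff {I : Ideal SmoothGerm} {s : ℕ}
    {m n : Fin s → ℕ} (h : IsIntrinsicPresentation I s m n) {e : ℕ × ℕ} :
    e ∈ exponents I ↔ ∃ i, n i ≤ e.2 ∧ m i + n i ≤ e.1 + e.2 := by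
  change monomialGerm e ∈ I ↔ _
  rw [h.2.2, iSup_maxIdeal_pow_mul_span, monomialGerm_mem_span_iff]
  constructor
  · rintro ⟨e₀, ⟨i, hsnd, hdeg⟩, hle⟩
    exact ⟨i, hsnd.trans hle.2, hdeg.trans (add_le_add hle.1 hle.2)⟩
  · exact fun he => ⟨e, he, le_rfl⟩

theorem intrinsicGenerators_subset (I : Ideal SmoothGerm) :
    intrinsicGenerators I ⊆ minimalMonomials (exponents I) := by
  rintro _ ⟨s, m, n, h, i, rfl⟩
  refine mem_minimalMonomials.2 ⟨_, ⟨h.mem_exponents_iff.2 ⟨i, le_rfl, le_rfl⟩, ?_⟩, rfl⟩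
  rintro e he hle
  obtain ⟨j, hsnd, hdeg⟩ := h.mem_exponents_iff.1 he
  have hji : j ≤ i := h.1.le_iff_le.1 (hsnd.trans hle.2)
  have hij : i ≤ j := h.2.1.le_iff_ge.1 (hdeg.trans (add_le_add hle.1 hle.2))
  obtain rfl := hij.antisymm hji
  exact ⟨by linarith [hle.2], hsnd⟩

theorem IsIntrinsic.exists_mem_exponents_iff {I : Ideal SmoothGerm} (hI : IsIntrinsic I) :
    ∃ (s : ℕ) (m n : Fin s → ℕ), StrictMono n ∧ StrictAnti (fun i => m i + n i) ∧
      ∀ e, e ∈ exponents I ↔ ∃ i, n i ≤ e.2 ∧ m i + n i ≤ e.1 + e.2 := by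
  let T : Set (ℕ × ℕ) := (fun e => (e.2, e.1 + e.2)) '' exponents I
  have hanti := setOfPred_minimal_antichain (· ∈ T)
  obtain ⟨s, n, d, hn, hd, hrange⟩ := exists_strictMono_strictAnti_range_eq
    (WellQuasiOrderedLE.finite_of_isAntichain hanti) hanti
  have hcorner (i : Fin s) : (n i, d i) ∈ T := (hrange.le ⟨i, rfl⟩ : Minimal (· ∈ T) _).1
  choose e he heq using hcorner
  simp only [Prod.mk.injEq] at heq
  have hdeg (i : Fin s) : (e i).1 + n i = d i := by rw [← (heq i).1, (heq i).2]
  refine ⟨s, fun i => (e i).1, n, hn, by simpa only [hdeg] using hd, fun e' => ⟨fun he' => ?_, ?_⟩⟩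
  · obtain ⟨t, hle, ht⟩ := exists_minimal_le_of_wellFoundedLT (· ∈ T) _ ⟨e', he', rfl⟩
    obtain ⟨i, rfl⟩ := hrange.ge ht
    exact ⟨i, hle.1, (hdeg i).trans_le hle.2⟩
  · rintro ⟨i, hsnd, hle⟩
    exact hI.monomialGerm_mem (he i) ((heq i).1.trans_le hsnd) (by rwa [(heq i).1])

theorem IsIntrinsic.exists_presentation {I : Ideal SmoothGerm} (hI : IsIntrinsic I)
    (hmon : IsMonomialIdeal I) :
    ∃ (s : ℕ) (m n : Fin s → ℕ), IsIntrinsicPresentation I s m n ∧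
      (HasFiniteCodim (I.restrictScalars ℝ) → ∃ i, n i = 0) := by
  obtain ⟨s, m, n, hn, hmn, hmem⟩ := hI.exists_mem_exponents_iff
  refine ⟨s, m, n, ⟨hn, hmn, ?_⟩, ?_⟩
  · have hexp : exponents I = {e | ∃ i, n i ≤ e.2 ∧ m i + n i ≤ e.1 + e.2} := Set.ext hmem
    rw [iSup_maxIdeal_pow_mul_span, ← hexp]
    exact hmon.eq_span_exponents
  · rintro ⟨k, hk⟩
    obtain ⟨i, hi, -⟩ := (hmem (k, 0)).1 (hk (monomialGerm_mem_maxIdeal_pow le_self_add))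
    exact ⟨i, Nat.le_zero.1 hi⟩

/-! ### Reduction modulo the monomials of an ideal -/

/-- `g` is reduced modulo the monomials of `J` when its Taylor expansion has no term whose exponent
is that of a monomial in `J`. -/
def IsReducedMod (J : Ideal SmoothGerm) (g : SmoothGerm) : Prop :=
  ∀ e ∈ exponents J, taylorCoeff g e = 0

theorem exists_eq_add_xGerm_pow_mul_add_lGerm_mul (k : ℕ) (f : SmoothGerm) :
    ∃ p q r : SmoothGerm, f = p + xGerm ^ k * q + lGerm * r ∧
      ∀ e, taylorCoeff p e ≠ 0 → e.1 < k ∧ e.2 = 0 := by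
  induction k with
  | zero => exact ⟨0, f, 0, by simp, fun e h => absurd (taylorCoeff_zero e) h⟩
  | succ k ih =>
    obtain ⟨p, q, r, hf, hp⟩ := ih
    obtain ⟨q', r', hq⟩ := exists_eq_algebraMap_add q
    refine ⟨p + evalZero q • monomialGerm (k, 0), q', r + xGerm ^ k * r', ?_, fun e he => ?_⟩
    · rw [Algebra.smul_def, monomialGerm]
      linear_combination hf + xGerm ^ k * hq
    · by_cases hpe : taylorCoeff p e = 0
      · rw [taylorCoeff_add, hpe, zero_add, taylorCoeff_smul, taylorCoeff_monomialGerm] at he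
        obtain rfl : e = (k, 0) := by_contra fun h => he (by rw [if_neg h, mul_zero])
        exact ⟨k.lt_succ_self, rfl⟩
      · exact ⟨(hp e hpe).1.trans k.lt_succ_self, (hp e hpe).2⟩

theorem exists_isReducedMod_sub_add_lGerm_mul_mem (J : Ideal SmoothGerm) (f : SmoothGerm) :
    ∃ p r, f - (p + lGerm * r) ∈ J ∧ IsReducedMod J p ∧ ∀ a b, taylorCoeff p (a, b + 1) = 0 := by
  by_cases hrow : ∃ a, (a, 0) ∈ exponents J
  · classical
    obtain ⟨p, q, r, hf, hp⟩ := exists_eq_add_xGerm_pow_mul_add_lGerm_mul (Nat.find hrow) f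
    refine ⟨p, r, ?_, ?_, fun a b => by_contra fun h => b.succ_ne_zero (hp _ h).2⟩
    · have hrest : f - (p + lGerm * r) = monomialGerm (Nat.find hrow, 0) * q := by
        rw [monomialGerm]
        linear_combination hf
      exact hrest ▸ J.mul_mem_right q (Nat.find_spec hrow)
    · rintro ⟨a, b⟩ he
      by_contra h
      obtain ⟨hlt, rfl⟩ := hp _ h
      exact Nat.find_min hrow hlt he
  · obtain ⟨p, r, hf, hp⟩ := exists_eq_add_lGerm_mul f
    refine ⟨p, r, by simp [← hf], ?_, taylorCoeff_succ_eq_zero hp⟩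
    rintro ⟨a, _ | b⟩ he
    · exact absurd ⟨a, he⟩ hrow
    · exact taylorCoeff_succ_eq_zero hp a b

theorem exists_sub_mem_isReducedMod_of_lGerm_pow_mem {B : ℕ} {J : Ideal SmoothGerm}
    (hB : lGerm ^ B ∈ J) (f : SmoothGerm) : ∃ g, f - g ∈ J ∧ IsReducedMod J g := by
  induction B generalizing J f with
  | zero =>
    rw [pow_zero, ← Ideal.eq_top_iff_one] at hB
    exact ⟨0, hB ▸ Submodule.mem_top, fun e _ => taylorCoeff_zero e⟩
  | succ B ih =>
    let J' : Ideal SmoothGerm := Submodule.comap (LinearMap.mulLeft SmoothGerm lGerm) J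
    obtain ⟨p, r, hf, hp, hp_succ⟩ := exists_isReducedMod_sub_add_lGerm_mul_mem J f
    obtain ⟨g, hg, hg_red⟩ := ih (J := J') (by simpa [J', ← pow_succ'] using hB) r
    refine ⟨p + lGerm * g, ?_, ?_⟩
    · have hsplit : f - (p + lGerm * g) = f - (p + lGerm * r) + lGerm * (r - g) := by ring
      exact hsplit ▸ add_mem hf hg
    · rintro ⟨a, _ | b⟩ he
      · rw [taylorCoeff_add, taylorCoeff_lGerm_mul_zero, add_zero, hp _ he]
      · have he' : (a, b) ∈ exponents J' := by
          change lGerm * monomialGerm (a, b) ∈ J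
          rwa [monomialGerm, mul_left_comm, ← pow_succ']
        rw [taylorCoeff_add, taylorCoeff_lGerm_mul_succ, hp_succ, zero_add, hg_red _ he']

theorem IsIntrinsic.exists_sub_mem_isReducedMod {J : Ideal SmoothGerm} (hJ : IsIntrinsic J)
    (f : SmoothGerm) : ∃ g, f - g ∈ J ∧ IsReducedMod J g := by
  rcases (exponents J).eq_empty_or_nonempty with hempty | ⟨e, he⟩
  · exact ⟨f, by simp, fun e he => by simp [hempty] at he⟩
  · have hl : monomialGerm (0, e.1 + e.2) ∈ J :=
      hJ.monomialGerm_mem he (Nat.le_add_left _ _) (by simp)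
    exact exists_sub_mem_isReducedMod_of_lGerm_pow_mem (by simpa [monomialGerm] using hl) f

theorem IsReducedMod.notMem_of_mem_terms {J : Ideal SmoothGerm} {g p : SmoothGerm}
    (hg : IsReducedMod J g) (hp : p ∈ terms g) : p ∉ J := by
  obtain ⟨e, he, rfl⟩ := hp
  exact fun h => he (hg e ((smul_monomialGerm_mem_iff he).1 h))

theorem IsReducedMod.not_dvd_of_mem_terms {J : Ideal SmoothGerm} {g p f : SmoothGerm}
    (hg : IsReducedMod J g) (hp : p ∈ terms g) (hf : f ∈ minimalMonomials (exponents J)) :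
    ¬ f ∣ p := by
  obtain ⟨e, he, rfl⟩ := mem_minimalMonomials.1 hf
  exact fun h => hg.notMem_of_mem_terms hp (J.mem_of_dvd h he.1)

theorem inter_iUnion_terms_eq_empty {ι : Type*} {J : Ideal SmoothGerm} {g : ι → SmoothGerm}
    (hg : ∀ i, IsReducedMod J (g i)) : (J : Set SmoothGerm) ∩ ⋃ i, terms (g i) = ∅ := by
  refine Set.disjoint_iff_inter_eq_empty.1 (Set.disjoint_iUnion_right.2 fun i => ?_)
  exact Set.disjoint_right.2 fun p hp => (hg i).notMem_of_mem_terms hp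

theorem sup_span_range_eq_of_sub_mem {R M ι : Type*} [Ring R] [AddCommGroup M] [Module R M]
    {W : Submodule R M} {v g : ι → M} (h : ∀ i, v i - g i ∈ W) :
    W ⊔ Submodule.span R (Set.range v) = W ⊔ Submodule.span R (Set.range g) := by
  have hquot : W.mkQ ∘ v = W.mkQ ∘ g := funext fun i => (Submodule.Quotient.eq W).2 (h i)
  rw [← Submodule.comap_map_mkQ, ← Submodule.comap_map_mkQ, Submodule.map_span,
    Submodule.map_span, ← Set.range_comp, ← Set.range_comp, hquot]

/-! ### Intrinsic parts -/

theorem isIntrinsic_intrinsicPart (V : Submodule ℝ SmoothGerm) : IsIntrinsic (intrinsicPart V) :=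
  (intrinsicPart_isGreatest V).1.1

theorem restrictScalars_intrinsicPart_le (V : Submodule ℝ SmoothGerm) :
    (intrinsicPart V).restrictScalars ℝ ≤ V :=
  (intrinsicPart_isGreatest V).1.2

theorem HasFiniteCodim.restrictScalars_intrinsicPart {V : Submodule ℝ SmoothGerm}
    (hV : HasFiniteCodim V) : HasFiniteCodim ((intrinsicPart V).restrictScalars ℝ) := by
  obtain ⟨k, hk⟩ := hV
  exact ⟨k, (intrinsicPart_isGreatest V).2 ⟨isIntrinsic_maxIdeal_pow k, hk⟩⟩

theorem HasFiniteCodim.isMonomialIdeal_intrinsicPart {V : Submodule ℝ SmoothGerm}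
    (hV : HasFiniteCodim V) : IsMonomialIdeal (intrinsicPart V) :=
  (isIntrinsic_intrinsicPart V).isMonomialIdeal hV.restrictScalars_intrinsicPart

theorem HasFiniteCodim.exists_eq_sup_span_range {V W : Submodule ℝ SmoothGerm}
    (hW : HasFiniteCodim W) (hWV : W ≤ V) :
    ∃ (r : ℕ) (v : Fin r → SmoothGerm), W ⊔ Submodule.span ℝ (Set.range v) = V := by
  obtain ⟨k, hk⟩ := hW
  have hkW : (maxIdeal ^ k).restrictScalars ℝ ≤ W := hk
  let P := Submodule.span ℝ (monomialGerm '' {e | e.1 + e.2 < k})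
  have hP : P ⊔ W = ⊤ := top_unique <|
    (span_monomialGerm_sup_maxIdeal_pow_eq_top k).ge.trans (sup_le_sup_left hkW P)
  have hfin : {e : ℕ × ℕ | e.1 + e.2 < k}.Finite :=
    (Set.finite_Iic (k, k)).subset fun e he =>
      ⟨(Nat.le_add_right _ _).trans he.le, (Nat.le_add_left _ _).trans he.le⟩
  have : FiniteDimensional ℝ P := .span_of_finite ℝ (hfin.image _)
  obtain ⟨r, v, hv⟩ := Submodule.fg_iff_exists_fin_generating_family.1
    (Module.Finite.iff_fg.1 (Submodule.finiteDimensional_of_le (inf_le_left : P ⊓ V ≤ P)))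
  exact ⟨r, v, by rw [hv, ← sup_inf_assoc_of_le P hWV, sup_comm, hP, top_inf_eq]⟩

end SingularityGerms

end

theorem mainTheorem9 (ord : SingularityGerms.LocalOrder) :
    -- an intrinsic ideal has a reduced monomial standard basis with its intrinsic generators
    (∀ I : Ideal SingularityGerms.SmoothGerm, SingularityGerms.IsIntrinsic I →
      (SingularityGerms.HasFiniteCodim (I.restrictScalars ℝ) ∨
        SingularityGerms.IsMonomialIdeal I) →
      (∃ (s : ℕ) (m n : Fin s → ℕ), SingularityGerms.IsIntrinsicPresentation I s m n ∧
        (SingularityGerms.HasFiniteCodim (I.restrictScalars ℝ) → ∃ i, n i = 0)) ∧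
      ∃ F : Finset SingularityGerms.SmoothGerm,
        SingularityGerms.IsReducedMonomialStandardBasis ord I F ∧
        SingularityGerms.intrinsicGenerators I ⊆ F) ∧
    -- decomposition of a vector subspace of finite codimension
    (∀ V : Submodule ℝ SingularityGerms.SmoothGerm, SingularityGerms.HasFiniteCodim V →
      ∃ (F : Finset SingularityGerms.SmoothGerm) (r : ℕ)
        (g : Fin r → SingularityGerms.SmoothGerm),
        SingularityGerms.IsReducedMonomialStandardBasis ord
          (SingularityGerms.intrinsicPart V) F ∧
        V = (SingularityGerms.intrinsicPart V).restrictScalars ℝ ⊔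
          Submodule.span ℝ (Set.range g) ∧
        (∀ i, ∀ p ∈ SingularityGerms.terms (g i), ∀ f ∈ F, ¬ f ∣ p) ∧
        (SingularityGerms.intrinsicPart V : Set SingularityGerms.SmoothGerm) ∩
          (⋃ i, SingularityGerms.terms (g i)) = ∅) ∧
    -- decomposition of a finitely generated ideal
    (∀ I : Ideal SingularityGerms.SmoothGerm, I.FG →
      ∃ (F : Finset SingularityGerms.SmoothGerm) (r : ℕ)
        (g : Fin r → SingularityGerms.SmoothGerm),
        SingularityGerms.IsReducedMonomialStandardBasis ord
          (SingularityGerms.monomialPart (SingularityGerms.intrinsicPartIdeal I)) F ∧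
        (SingularityGerms.HasFiniteCodim (I.restrictScalars ℝ) ∨
            SingularityGerms.IsMonomialIdeal (SingularityGerms.intrinsicPartIdeal I) →
          SingularityGerms.IsReducedMonomialStandardBasis ord
            (SingularityGerms.intrinsicPartIdeal I) F) ∧
        I = SingularityGerms.intrinsicPartIdeal I ⊔ Ideal.span (Set.range g) ∧
        (∀ i, ∀ p ∈ SingularityGerms.terms (g i), ∀ f ∈ F, ¬ f ∣ p) ∧
        (SingularityGerms.intrinsicPartIdeal I : Set SingularityGerms.SmoothGerm) ∩
          (⋃ i, SingularityGerms.terms (g i)) = ∅) := by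
  open SingularityGerms in
  refine ⟨fun I hI h => ?_, fun V hV => ?_, fun I hfg => ?_⟩
  · have hmon : IsMonomialIdeal I := h.elim hI.isMonomialIdeal id
    exact ⟨hI.exists_presentation hmon, minimalMonomials (exponents I),
      hmon.isReducedMonomialStandardBasis ord, intrinsicGenerators_subset I⟩
  · obtain ⟨r, v, hv⟩ := hV.restrictScalars_intrinsicPart.exists_eq_sup_span_range
      (restrictScalars_intrinsicPart_le V)
    choose g hsub hg using fun i => (isIntrinsic_intrinsicPart V).exists_sub_mem_isReducedMod (v i)
    refine ⟨minimalMonomials (exponents (intrinsicPart V)), r, g,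
      hV.isMonomialIdeal_intrinsicPart.isReducedMonomialStandardBasis ord, ?_,
      fun i p hp f hf => (hg i).not_dvd_of_mem_terms hp hf, inter_iUnion_terms_eq_empty hg⟩
    exact hv.symm.trans
      (sup_span_range_eq_of_sub_mem (W := (intrinsicPart V).restrictScalars ℝ) hsub)
  · obtain ⟨r, v, hv⟩ := Submodule.fg_iff_exists_fin_generating_family.1 hfg
    have hJ : IsIntrinsic (intrinsicPartIdeal I) := isIntrinsic_intrinsicPart _
    have hJI : intrinsicPartIdeal I ≤ I := restrictScalars_intrinsicPart_le _
    choose g hsub hg using fun i => hJ.exists_sub_mem_isReducedMod (v i)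
    refine ⟨minimalMonomials (exponents (intrinsicPartIdeal I)), r, g,
      isReducedMonomialStandardBasis_monomialPart ord _, fun h => ?_, ?_,
      fun i p hp f hf => (hg i).not_dvd_of_mem_terms hp hf, inter_iUnion_terms_eq_empty hg⟩
    · exact IsMonomialIdeal.isReducedMonomialStandardBasis
        (h.elim HasFiniteCodim.isMonomialIdeal_intrinsicPart id) ord
    · rw [← sup_span_range_eq_of_sub_mem hsub, hv, sup_eq_right.2 hJI]
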